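/- Write $\mathbb{R}$ for Baire space $\omega^\omega$. For $k\in\omega$, $r\in\mathbb{R}$ let $k^\smallfrown r$ be the real with first entry $k$ followed by $r$, and for $F\colon\mathbb{R}\to\omega$ let $F*r\in\mathbb{R}$ be given by $(F*r)(k)=F(k^\smallfrown r)$; pairs $\langle a,b\rangle$ and finite strings of reals are coded by reals in a fixed standard way. Let $\mathcal{B}=(\omega,\mathbb{R},\{F\colon\mathbb{R}\to\omega : F\text{ Borel}\})$ be the $\omega$-model whose type-1 objects are all reals and whose type-2 objects are the Borel functions $\mathbb{R}\to\omega$. A well-ordering of a set of reals in $\mathcal{B}$ is a Borel functional $W\colon\mathbb{R}\to\{0,1,2\}$ such that $W(\langle a,b\rangle)=0$ if $a<_W b$, $1$ if $b\le_W a$, and $2$ if $a,b$ are not both in $\mathrm{dom}(W)$, where $<_W$ is a well-ordering of the set $\mathrm{dom}(W)\subseteq\mathbb{R}$. $\mathsf{CWO}^{\mathbb{R}}$ says: for any two well-orderings $X,Y$ of sets of reals there is a type-2 functional $F$ such that $a\mapsto F*a$ is an order embedding of one of them into the other. A tree is a nonempty set $T\subseteq\mathbb{R}^{<\omega}$ closed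 under initial segments, given by a type-2 functional; a strategy is a map $\mathbb{R}^{<\omega}\to\mathbb{R}$ of the form $\sigma\mapsto S*\sigma$ with $S$ a type-2 functional. For strategies $\Sigma$ (player I, who moves first) and $\Pi$ (player II), let $(\Sigma\otimes\Pi)_k$ be the string of the first $k$ moves. $\Sigma$ is winning for I if for every strategy $\Pi$ there is $k$ with $(\Sigma\otimes\Pi)_{2k+1}\in T$ and $(\Sigma\otimes\Pi)_{2k+2}\notin T$; $\Pi$ is winning for II if for every strategy $\Sigma$ there is $k$ with $(\Sigma\otimes\Pi)_{2k}\in T$ and $(\Sigma\otimes\Pi)_{2k+1}\notin T$. (All strategies range over those of the model.) $\Delta_1^{\mathbb{R}}$-$\mathsf{Det}$ says: for every well-founded tree $T$ one of the players has a winning strategy. Lemma. $\mathcal{B}\models\mathsf{CWO}^{\mathbb{R}}+\neg\,\Delta_1^{\mathbb{R}}\text{-}\mathsf{Det}$. Moreover: (a) every Borel well-ordering of a set of reals has countable domain; (b) the failure of $\Delta_1^{\mathbb{R}}$-$\mathsf{Det}$ is witnessed as follows: there are an analytic set $X\subseteq\mathbb{R}$ which is not Borel and a closed set $C\subseteq\mathbb{R}\times\mathbb{R}$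 whose projection to the first coordinate is $X$, such that the following game is a Borel well-founded tree and neither player has a winning strategy in $\mathcal{B}$: player I plays a real $a$; player II plays a real $c$, guessing that $a\in X$ if $c(0)\neq 0$ and that $a\notin X$ if $c(0)=0$; then, if II guessed $a\notin X$, player I plays a real $b$ and wins iff $(a,b)\in C$, and if II guessed $a\in X$, player I makes an irrelevant move, after which II plays a real $b$ and wins iff $(a,b)\in C$. -/

import Mathlib

noncomputable section

namespace HigherRM

/-- The reals, taken (as usual in this subject) to be the functions from `ℕ` to `ℕ`, i.e. Baire
space. It carries Mathlib's product topology and product (equivalently Borel) sigma-algebra. -/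
abbrev Baire : Type := ℕ → ℕ

/-- `k ⌢ r`: the real with first entry `k`, followed by `r`. -/
def concat (k : ℕ) (r : Baire) : Baire
  | 0 => k
  | n + 1 => r n

/-- The operation `F * r`, given by `(F * r)(k) = F (k ⌢ r)`. It turns a type-2 functional into a map
from reals to reals. -/
def starMap (F : Baire → ℕ) (r : Baire) : Baire := fun k => F (concat k r)

/-- Pairing of reals, pointwise. -/
def pair (x y : Baire) : Baire := fun n => Nat.pair (x n) (y n)

/-- A (full) omega-model `(ω, ℝ, M₂)`: the objects of type 0 are the natural numbers, those of type 1
are all reals, and those of type 2 are the members of the given set of functionals `ℝ → ω`. The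
operations of the language have their standard meaning, so the model is determined by this set. -/
structure OmegaModel where
  functionals : Set (Baire → ℕ)

/-- The model whose type-2 objects are the Borel functions `ℝ → ω`. -/
def borelModel : OmegaModel := ⟨{F | Measurable F}⟩

/-! ### Well-orderings of sets of reals -/

/-- The domain of the relation coded by `W`. -/
def dom (W : Baire → ℕ) : Set Baire := {a | W (pair a a) ≠ 2}

/-- `W` codes a well-ordering of the set of reals `dom W`: it takes only the values `0, 1, 2`;
`W ⟨a, b⟩ = 2` if and only if `a, b` are not both in the domain; and `a <_W b`, i.e. `W ⟨a, b⟩ = 0`, is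
a (strict) well-ordering of the domain. So, for `a, b` in the domain, `W ⟨a, b⟩ = 1` iff `b ≤_W a`. -/
structure IsWellOrdering (W : Baire → ℕ) : Prop where
  lt_three : ∀ x, W x < 3
  eq_two_iff : ∀ a b, W (pair a b) = 2 ↔ ¬ (a ∈ dom W ∧ b ∈ dom W)
  wellOrder : IsWellOrder (dom W) (fun a b => W (pair a b) = 0)

/-- The functional `F`, acting on reals by `a ↦ F * a`, is an embedding of the ordering coded by `X`
into the one coded by `Y`. -/
def IsEmbedding (F X Y : Baire → ℕ) : Prop :=
  (∀ a ∈ dom X, starMap F a ∈ dom Y) ∧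
    ∀ a ∈ dom X, ∀ b ∈ dom X, X (pair a b) = 0 ↔ Y (pair (starMap F a) (starMap F b)) = 0

/-- `M` satisfies the comparability of well-orderings of sets of reals. -/
def OmegaModel.CWO (M : OmegaModel) : Prop :=
  ∀ X ∈ M.functionals, ∀ Y ∈ M.functionals, IsWellOrdering X → IsWellOrdering Y →
    ∃ F ∈ M.functionals, IsEmbedding F X Y ∨ IsEmbedding F Y X

/-! ### Clopen games on reals -/

/-- Finite strings of reals are coded by reals: the first entry is the length of the string, the
entry number `1 + ⟨i, n⟩` is the `n`-th entry of the `i`-th term of the string (`0` if there is no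
such term). -/
def code (σ : List Baire) : Baire
  | 0 => σ.length
  | m + 1 => σ.getD m.unpair.1 0 m.unpair.2

/-- The set of strings coded by a type-2 functional. -/
def strings (T : Baire → ℕ) : Set (List Baire) := {σ | T (code σ) = 1}

/-- The canonical type-2 functional coding a set of strings: the characteristic function of the set
of codes. -/
def charFun (T : Set (List Baire)) : Baire → ℕ := (code '' T).indicator 1

/-- A (nonempty) tree of finite strings of reals. -/
def IsTree (T : Set (List Baire)) : Prop :=
  [] ∈ T ∧ ∀ (σ : List Baire) (a : Baire), σ ++ [a] ∈ T → σ ∈ T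

/-- A tree is well-founded if it has no infinite path. -/
def IsWellFounded (T : Set (List Baire)) : Prop :=
  ¬ ∃ f : ℕ → Baire, ∀ k : ℕ, (List.range k).map f ∈ T

/-- The strategy coded by a functional `S`: it maps a finite string of reals `σ` to the
real `S * code σ`. -/
def strategy (S : Baire → ℕ) (σ : List Baire) : Baire := starMap S (code σ)

/-- The first `k` moves `(S ⊗ P)_k` of the play in which player I uses `S` and player II uses `P`.
Player I moves first. -/
def play (S P : List Baire → Baire) : ℕ → List Baire
  | 0 => []
  | k + 1 => play S P k ++ [if Even k then S (play S P k) else P (play S P k)]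

/-- In `M`, player I has a winning strategy in the game on `T`, where the first player who leaves the
tree loses. -/
def OmegaModel.WinI (M : OmegaModel) (T : Set (List Baire)) : Prop :=
  ∃ S ∈ M.functionals, ∀ P ∈ M.functionals, ∃ k : ℕ,
    play (strategy S) (strategy P) (2 * k + 1) ∈ T ∧
      play (strategy S) (strategy P) (2 * k + 2) ∉ T

/-- In `M`, player II has a winning strategy in the game on `T`. -/
def OmegaModel.WinII (M : OmegaModel) (T : Set (List Baire)) : Prop :=
  ∃ P ∈ M.functionals, ∀ S ∈ M.functionals, ∃ k : ℕ,
    play (strategy S) (strategy P) (2 * k) ∈ T ∧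
      play (strategy S) (strategy P) (2 * k + 1) ∉ T

/-- `M` satisfies clopen determinacy for reals. -/
def OmegaModel.ClopenDet (M : OmegaModel) : Prop :=
  ∀ T ∈ M.functionals, IsTree (strings T) → IsWellFounded (strings T) →
    M.WinI (strings T) ∨ M.WinII (strings T)

/-- The guessing game of a set `C` of pairs of reals, as a tree. Player I plays a real `a`; player II
plays `c` and thereby guesses whether `a` is in the projection of `C` (`c 0 = 0` means no, `c 0 ≠ 0`
means yes). After "no", player I plays `b` and wins iff `(a, b) ∈ C`. After "yes", player I makes
an irrelevant move, and then player II plays `b` and wins iff `(a, b) ∈ C`. -/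
def guessingGame (C : Set (Baire × Baire)) : Set (List Baire) :=
  {σ | match σ with
    | [] => True
    | [_] => True
    | [_, _] => True
    | [a, c, b] => c 0 = 0 → (a, b) ∈ C
    | [a, c, _, b] => c 0 ≠ 0 ∧ (a, b) ∈ C
    | _ => False}

end HigherRM

end

open HigherRM

/-! A measurable well-ordering of an atomless s-finite measure space forces the measure to vanish:
pass to the least initial segment of positive measure, if there is one, so that all initial segments
within it are null; by Fubini almost all final segments are null as well, and an initial and a final
segment cover everything but one point. Hence Borel well-orderings are countable. Every map from a
countable set of reals to the reals is induced by a Borel functional, so comparability of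
well-orderings in the model reduces to the comparability of arbitrary well-orderings.

In the guessing game of `C`, a winning strategy of player II guesses correctly at every `a`, so it
decides membership in the projection of `C`; if it is Borel, then so is the projection. Player I
cannot win, because one of the two guesses about his first move is right, and player II makes it
and, if necessary, plays a suitable `b` by a strategy that looks only at the number of moves made.
For `C` take the `(a, b)` such that `(a, (a, b))` lies in a universal closed set: were its
projection Borel, the complement would be the projection of a closed set, and the code of that
closed set would yield a contradiction. -/

namespace HigherRM

open MeasureTheory Set TopologicalSpace

section MeasurableWellOrder

variable {α : Type*} [MeasurableSpace α] {r : α → α → Prop}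

theorem measure_eq_zero_of_ae_ae_not_rel [Std.Trichotomous r] {μ : Measure α} [SFinite μ]
    [NullSingletonClass μ] (hr : MeasurableSet {p : α × α | r p.1 p.2})
    (hinit : ∀ᵐ y ∂μ, ∀ᵐ x ∂μ, ¬ r x y) : μ = 0 := by
  have hfinal : ∀ᵐ x ∂μ, ∀ᵐ y ∂μ, ¬ r x y := (Measure.ae_ae_comm hr.compl).2 hinit
  by_contra hμ
  have : (ae μ).NeBot := ae_neBot.2 hμ
  obtain ⟨x, hbelow, habove⟩ := (hinit.and hfinal).exists
  have hne : ∀ᵐ z ∂μ, z ≠ x := measure_eq_zero_iff_ae_notMem.1 (measure_singleton x)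
  obtain ⟨z, hzx, hxz, hz⟩ := (hbelow.and (habove.and hne)).exists
  exact hz (Std.Trichotomous.trichotomous z x hzx hxz)

theorem measure_eq_zero_of_measurableSet_wellOrder [IsWellOrder α r] (μ : Measure α) [SFinite μ]
    [NullSingletonClass μ] (hr : MeasurableSet {p : α × α | r p.1 p.2}) : μ = 0 := by
  by_cases hnull : ∀ y, ∀ᵐ x ∂μ, ¬ r x y
  · exact measure_eq_zero_of_ae_ae_not_rel hr (.of_forall hnull)
  obtain ⟨y, hy, hmin⟩ := (IsWellFounded.wf (r := r)).has_min {y | ¬ ∀ᵐ x ∂μ, ¬ r x y}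
    (not_forall.1 hnull)
  refine absurd ?_ hy
  have hseg : MeasurableSet {x | r x y} := measurable_prodMk_right hr
  have hzero : μ.restrict {x | r x y} = 0 := by
    refine measure_eq_zero_of_ae_ae_not_rel hr ((ae_restrict_iff' hseg).2 (.of_forall ?_))
    exact fun z hzy => ae_restrict_of_ae (not_not.1 fun hz => hmin z hz hzy)
  exact measure_eq_zero_iff_ae_notMem.1 (Measure.restrict_eq_zero.1 hzero)

theorem countable_of_measurableSet_wellOrder [StandardBorelSpace α] [IsWellOrder α r]
    (hr : MeasurableSet {p : α × α | r p.1 p.2}) : Countable α := by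
  by_contra hα
  let e : ℝ ≃ᵐ α := PolishSpace.measurableEquivOfNotCountable not_countable hα
  have : IsWellOrder ℝ (e ⁻¹'o r) := (RelIso.preimage e.toEquiv r).toRelEmbedding.isWellOrder
  have hpull : MeasurableSet {p : ℝ × ℝ | (e ⁻¹'o r) p.1 p.2} :=
    (e.measurable.prodMap e.measurable) hr
  exact NeZero.ne (volume : Measure ℝ) (measure_eq_zero_of_measurableSet_wellOrder _ hpull)

end MeasurableWellOrder

section WellOrderings

/-- The strict order `<_W` on the domain of the relation coded by `W`. -/
def domLT (W : Baire → ℕ) (a b : dom W) : Prop := W (pair a b) = 0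

theorem measurable_pair : Measurable fun p : Baire × Baire => pair p.1 p.2 := by
  refine measurable_pi_lambda _ fun n => ?_
  have hentries : Measurable fun p : Baire × Baire => (p.1 n, p.2 n) := by fun_prop
  exact (Measurable.of_discrete (f := fun q : ℕ × ℕ => Nat.pair q.1 q.2)).comp hentries

theorem measurableSet_dom {W : Baire → ℕ} (hW : Measurable W) : MeasurableSet (dom W) :=
  (hW.comp (measurable_pair.comp (measurable_id.prodMk measurable_id)))
    (MeasurableSet.of_discrete (s := {2}ᶜ))

theorem measurableSet_domLT {W : Baire → ℕ} (hW : Measurable W) :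
    MeasurableSet {p : dom W × dom W | domLT W p.1 p.2} :=
  (hW.comp (measurable_pair.comp (measurable_subtype_coe.prodMap measurable_subtype_coe)))
    (MeasurableSet.of_discrete (s := {0}))

theorem IsWellOrdering.countable_dom {W : Baire → ℕ} (h : IsWellOrdering W) (hW : Measurable W) :
    (dom W).Countable := by
  have : StandardBorelSpace (dom W) := (measurableSet_dom hW).standardBorel
  have : IsWellOrder (dom W) (domLT W) := h.wellOrder
  exact countable_coe_iff.1 (countable_of_measurableSet_wellOrder (measurableSet_domLT hW))

theorem concat_injective2 : Function.Injective2 concat := fun _ _ _ _ h =>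
  ⟨congrFun h 0, funext fun n => congrFun h (n + 1)⟩

theorem exists_measurable_starMap_eq {D : Set Baire} (hD : D.Countable) (f : D → Baire) :
    ∃ F : Baire → ℕ, Measurable F ∧ ∀ a : D, starMap F a = f a := by
  have : Countable D := hD.to_subtype
  let cons : ℕ × D → Baire := fun p => concat p.1 p.2
  have hcons : Function.Injective cons := fun _ _ h =>
    Prod.ext (concat_injective2 h).1 (Subtype.ext (concat_injective2 h).2)
  refine ⟨Function.extend cons (fun p => f p.2 p.1) 0, ?_, fun a => funext fun k => ?_⟩
  · refine Measurable.measurable_of_countable_ne measurable_zero ((countable_range cons).mono ?_)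
    intro x hx
    by_contra hxr
    exact hx (Function.extend_apply' _ _ _ hxr).symm
  · exact hcons.extend_apply _ _ (k, a)

theorem exists_isEmbedding_of_relEmbedding {X Y : Baire → ℕ} (hX : (dom X).Countable)
    (f : domLT X ↪r domLT Y) : ∃ F ∈ borelModel.functionals, IsEmbedding F X Y := by
  obtain ⟨F, hF, hFf⟩ := exists_measurable_starMap_eq hX fun a => (f a : Baire)
  refine ⟨F, hF, fun a ha => ?_, fun a ha b hb => ?_⟩
  · rw [hFf ⟨a, ha⟩]
    exact (f ⟨a, ha⟩).2
  · rw [hFf ⟨a, ha⟩, hFf ⟨b, hb⟩]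
    exact (f.map_rel_iff (a := ⟨a, ha⟩) (b := ⟨b, hb⟩)).symm

theorem borelModel_cwo : borelModel.CWO := by
  intro X hX Y hY hWX hWY
  have : IsWellOrder (dom X) (domLT X) := hWX.wellOrder
  have : IsWellOrder (dom Y) (domLT Y) := hWY.wellOrder
  rcases InitialSeg.total (domLT X) (domLT Y) with f | f
  · obtain ⟨F, hF, hXY⟩ := exists_isEmbedding_of_relEmbedding (hWX.countable_dom hX)
      f.toRelEmbedding
    exact ⟨F, hF, .inl hXY⟩
  · obtain ⟨F, hF, hYX⟩ := exists_isEmbedding_of_relEmbedding (hWY.countable_dom hY)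
      f.toRelEmbedding
    exact ⟨F, hF, .inr hYX⟩

end WellOrderings

section NonBorelAnalytic

/-- A closed subset of `Baire × Y` whose vertical sections are exactly the closed subsets of `Y`.
The real `x` codes the closed set obtained by removing the basic open sets `s` with
`x (encode s) ≠ 0`. -/
def universalClosedSet (Y : Type*) [TopologicalSpace Y] [SecondCountableTopology Y] :
    Set (Baire × Y) :=
  {p | ∀ s : countableBasis Y, p.1 (Encodable.encode s) ≠ 0 → p.2 ∉ s.1}

variable {Y : Type*} [TopologicalSpace Y]

theorem isClosed_universalClosedSet [SecondCountableTopology Y] :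
    IsClosed (universalClosedSet Y) := by
  simp only [universalClosedSet, ofPred_forall]
  refine isClosed_iInter fun s => isClosed_imp ?_ ?_
  · have hcoord : Continuous fun p : Baire × Y => p.1 (Encodable.encode s) := by fun_prop
    exact (isOpen_discrete {0}ᶜ).preimage hcoord
  · exact ((isOpen_of_mem_countableBasis s.2).preimage continuous_snd).isClosed_compl

theorem exists_universalClosedSet_section_eq [SecondCountableTopology Y] {F : Set Y}
    (hF : IsClosed F) : ∃ x : Baire, ∀ y, (x, y) ∈ universalClosedSet Y ↔ y ∈ F := by
  classical
  refine ⟨(Encodable.encode '' {s : countableBasis Y | Disjoint s.1 F}).indicator 1, fun y => ?_⟩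
  have hy : y ∈ F ↔ ∀ s ∈ countableBasis Y, y ∈ s → (s ∩ F).Nonempty := by
    rw [← (isBasis_countableBasis Y).mem_closure_iff, hF.closure_eq]
  rw [hy]
  simp only [universalClosedSet, mem_ofPred_eq, ne_eq, indicator_eq_zero_iff_notMem, not_not,
    Encodable.encode_injective.mem_set_image, Subtype.forall]
  exact forall₂_congr fun s _ => by rw [← not_disjoint_iff_nonempty_inter, imp_not_comm]

theorem exists_isClosed_fst_image_eq_of_analyticSet [T2Space Y] {s : Set Y} (hs : AnalyticSet s) :
    ∃ F : Set (Y × Baire), IsClosed F ∧ Prod.fst '' F = s := by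
  rw [AnalyticSet] at hs
  rcases hs with rfl | ⟨f, hf, rfl⟩
  · exact ⟨∅, isClosed_empty, image_empty _⟩
  · refine ⟨{p | f p.2 = p.1}, isClosed_eq (hf.comp continuous_snd) continuous_fst, ?_⟩
    ext y
    simp

theorem exists_isClosed_not_measurableSet_fst_image :
    ∃ C : Set (Baire × Baire), IsClosed C ∧ ¬ MeasurableSet (Prod.fst '' C) := by
  refine ⟨(fun p => (p.1, p)) ⁻¹' universalClosedSet (Baire × Baire),
    isClosed_universalClosedSet.preimage (by fun_prop), fun hX => ?_⟩
  obtain ⟨F, hF, hFX⟩ := exists_isClosed_fst_image_eq_of_analyticSet hX.compl.analyticSet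
  obtain ⟨x, hx⟩ := exists_universalClosedSet_section_eq hF
  refine iff_not_self (a := x ∈ Prod.fst '' F) ?_
  nth_rw 1 [hFX]
  simp [hx]

end NonBorelAnalytic

section Coding

theorem code_injective : Function.Injective code := by
  intro σ τ h
  have hlen : σ.length = τ.length := congrFun h 0
  refine List.ext_getElem hlen fun i hσ hτ => funext fun n => ?_
  have hentry := congrFun h (Nat.pair i n + 1)
  simpa [code, hσ, hτ] using hentry

theorem strings_charFun (T : Set (List Baire)) : strings (charFun T) = T := by
  ext σ
  simp [strings, charFun, indicator_eq_one_iff_mem, code_injective.mem_set_image]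

theorem measurable_code_ofFn (n : ℕ) : Measurable fun v : Fin n → Baire => code (List.ofFn v) := by
  refine measurable_pi_lambda _ fun m => ?_
  cases m with
  | zero => simp [code]
  | succ m =>
    by_cases h : m.unpair.1 < n
    · simp only [code, List.getD_eq_getElem?_getD, List.getElem?_ofFn, h, dif_pos,
        Option.getD_some]
      exact (measurable_pi_apply _).comp (measurable_pi_apply _)
    · simp [code, h]

theorem measurable_charFun {T : Set (List Baire)}
    (hT : ∀ n, MeasurableSet {v : Fin n → Baire | List.ofFn v ∈ T}) : Measurable (charFun T) := by
  refine measurable_one.indicator ?_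
  have hcode : code '' T = ⋃ n, (fun v : Fin n → Baire => code (List.ofFn v)) ''
      {v | List.ofFn v ∈ T} := by
    ext x
    simp only [mem_image, mem_iUnion, mem_ofPred_eq]
    constructor
    · rintro ⟨σ, hσ, rfl⟩
      exact ⟨σ.length, σ.get, by simpa using hσ, by simp⟩
    · rintro ⟨n, v, hv, rfl⟩
      exact ⟨_, hv, rfl⟩
  rw [hcode]
  exact .iUnion fun n => (hT n).image_of_measurable_injOn (measurable_code_ofFn n)
    (code_injective.comp List.ofFn_injective).injOn

end Coding

section Strategies

theorem measurable_concat (k : ℕ) : Measurable (concat k) := by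
  refine measurable_pi_lambda _ fun n => ?_
  cases n with
  | zero => exact measurable_const
  | succ n => exact measurable_pi_apply n

theorem measurable_strategy_ofFn {S : Baire → ℕ} (hS : Measurable S) (n : ℕ) :
    Measurable fun v : Fin n → Baire => strategy S (List.ofFn v) :=
  measurable_pi_lambda _ fun k => hS.comp ((measurable_concat k).comp (measurable_code_ofFn n))

theorem exists_strategy_eq_length (f : ℕ → Baire) :
    ∃ S ∈ borelModel.functionals, ∀ σ, strategy S σ = f σ.length :=
  ⟨fun x => f (x 1) (x 0),
    (Measurable.of_discrete (f := fun q : ℕ × ℕ => f q.1 q.2)).comp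
      ((measurable_pi_apply (X := fun _ : ℕ => ℕ) 1).prodMk (measurable_pi_apply 0)),
    fun _ => rfl⟩

theorem length_play (S P : List Baire → Baire) (k : ℕ) : (play S P k).length = k := by
  induction k with
  | zero => rfl
  | succ k ih => simp [play, ih]

theorem OmegaModel.not_clopenDet_of_not_winI_of_not_winII {M : OmegaModel} {T : Set (List Baire)}
    (hM : charFun T ∈ M.functionals) (hT : IsTree T) (hwf : HigherRM.IsWellFounded T)
    (hI : ¬ M.WinI T) (hII : ¬ M.WinII T) : ¬ M.ClopenDet := by
  intro hdet
  have hwin := hdet (charFun T) hM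
  rw [strings_charFun] at hwin
  exact (hwin hT hwf).elim hI hII

end Strategies

section GuessingGame

variable {C : Set (Baire × Baire)}

theorem isTree_guessingGame (C : Set (Baire × Baire)) : IsTree (guessingGame C) := by
  refine ⟨trivial, fun σ a h => ?_⟩
  match σ with
  | [] | [_] | [_, _] => trivial
  | [_, _, _] => exact fun hc => absurd hc h.1
  | _ :: _ :: _ :: _ :: _ => simp [guessingGame] at h

theorem length_le_of_mem_guessingGame {σ : List Baire} (h : σ ∈ guessingGame C) :
    σ.length ≤ 4 := by
  match σ with
  | [] | [_] | [_, _] | [_, _, _] | [_, _, _, _] => simp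
  | _ :: _ :: _ :: _ :: _ :: _ => simp [guessingGame] at h

theorem isWellFounded_guessingGame (C : Set (Baire × Baire)) :
    HigherRM.IsWellFounded (guessingGame C) := by
  rintro ⟨f, hf⟩
  simpa using length_le_of_mem_guessingGame (hf 5)

theorem measurable_charFun_guessingGame (hC : MeasurableSet C) :
    Measurable (charFun (guessingGame C)) := by
  refine measurable_charFun fun n => ?_
  have hguess {m : ℕ} (i : Fin m) : MeasurableSet {v : Fin m → Baire | v i 0 = 0} :=
    ((measurable_pi_apply 0).comp (measurable_pi_apply i)) (MeasurableSet.of_discrete (s := {0}))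
  have hpair {m : ℕ} (i j : Fin m) : MeasurableSet {v : Fin m → Baire | (v i, v j) ∈ C} :=
    ((measurable_pi_apply i).prodMk (measurable_pi_apply j)) hC
  match n with
  | 0 | 1 | 2 => exact .const True
  | 3 => exact (hguess 1).imp (hpair 0 2)
  | 4 => exact (hguess 1).compl.inter (hpair 0 3)
  | n + 5 =>
    convert MeasurableSet.empty
    refine eq_empty_of_forall_notMem fun v hv => ?_
    have hlen := length_le_of_mem_guessingGame hv
    rw [List.length_ofFn] at hlen
    omega

theorem play_notMem_guessingGame {S P : List Baire → Baire} {k : ℕ} (hk : 4 < k) :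
    play S P k ∉ guessingGame C := fun h =>
  hk.not_ge (length_play S P k ▸ length_le_of_mem_guessingGame h)

theorem play_three_mem_guessingGame_iff (S P : List Baire → Baire) :
    play S P 3 ∈ guessingGame C ↔ (P [S []] 0 = 0 → (S [], S (play S P 2)) ∈ C) := by
  simp [play, guessingGame, Nat.even_add_one]

theorem play_four_mem_guessingGame_iff (S P : List Baire → Baire) :
    play S P 4 ∈ guessingGame C ↔ P [S []] 0 ≠ 0 ∧ (S [], P (play S P 3)) ∈ C := by
  simp [play, guessingGame, Nat.even_add_one]

theorem playerI_wins_guessingGame_iff (S P : List Baire → Baire) :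
    (∃ k, play S P (2 * k + 1) ∈ guessingGame C ∧ play S P (2 * k + 2) ∉ guessingGame C) ↔
      (P [S []] 0 = 0 → (S [], S (play S P 2)) ∈ C) ∧
        (P [S []] 0 ≠ 0 → (S [], P (play S P 3)) ∉ C) := by
  rw [← play_three_mem_guessingGame_iff, ← not_and, ← play_four_mem_guessingGame_iff]
  refine ⟨?_, fun h => ⟨1, h⟩⟩
  rintro ⟨k, hstay, hleave⟩
  match k with
  | 0 => exact absurd trivial hleave
  | 1 => exact ⟨hstay, hleave⟩
  | k + 2 => exact absurd hstay (play_notMem_guessingGame (by omega))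

theorem playerII_wins_guessingGame_iff (S P : List Baire → Baire) :
    (∃ k, play S P (2 * k) ∈ guessingGame C ∧ play S P (2 * k + 1) ∉ guessingGame C) ↔
      (P [S []] 0 = 0 → (S [], S (play S P 2)) ∉ C) ∧
        (P [S []] 0 ≠ 0 → (S [], P (play S P 3)) ∈ C) := by
  constructor
  · rintro ⟨k, hstay, hleave⟩
    match k with
    | 0 => exact absurd trivial hleave
    | 1 =>
      rw [play_three_mem_guessingGame_iff, Classical.not_imp] at hleave
      exact ⟨fun _ => hleave.2, fun hc => absurd hleave.1 hc⟩
    | 2 =>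
      rw [play_four_mem_guessingGame_iff] at hstay
      exact ⟨fun hc => absurd hc hstay.1, fun _ => hstay.2⟩
    | k + 3 => exact absurd hstay (play_notMem_guessingGame (by omega))
  · intro hwin
    by_cases hc : P [S []] 0 = 0
    · exact ⟨1, trivial, fun h => hwin.1 hc ((play_three_mem_guessingGame_iff S P).1 h hc)⟩
    · exact ⟨2, (play_four_mem_guessingGame_iff S P).2 ⟨hc, hwin.2 hc⟩,
        play_notMem_guessingGame (by omega)⟩

theorem not_winI_guessingGame (C : Set (Baire × Baire)) : ¬ borelModel.WinI (guessingGame C) := by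
  rintro ⟨S, -, hS⟩
  by_cases ha : ∃ b, (strategy S [], b) ∈ C
  · obtain ⟨b, hb⟩ := ha
    obtain ⟨P, hP, hPf⟩ := exists_strategy_eq_length fun n => if n = 1 then 1 else b
    have hI := (playerI_wins_guessingGame_iff _ _).1 (hS P hP)
    simp only [hPf, length_play] at hI
    exact hI.2 one_ne_zero hb
  · obtain ⟨P, hP, hPf⟩ := exists_strategy_eq_length fun _ => 0
    have hI := (playerI_wins_guessingGame_iff _ _).1 (hS P hP)
    exact ha ⟨_, hI.1 (by rw [hPf]; rfl)⟩

theorem mem_fst_image_iff_of_playerII_wins {P : List Baire → Baire}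
    (hP : ∀ S ∈ borelModel.functionals, ∃ k, play (strategy S) P (2 * k) ∈ guessingGame C ∧
      play (strategy S) P (2 * k + 1) ∉ guessingGame C) (a : Baire) :
    a ∈ Prod.fst '' C ↔ P [a] 0 ≠ 0 := by
  have hwin (b : Baire) : (P [a] 0 = 0 → (a, b) ∉ C) ∧ (P [a] 0 ≠ 0 → ∃ d, (a, d) ∈ C) := by
    obtain ⟨S, hS, hSf⟩ := exists_strategy_eq_length fun n => if n = 0 then a else b
    have hII := (playerII_wins_guessingGame_iff _ _).1 (hP S hS)
    simp only [hSf, length_play] at hII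
    exact hII.imp_right fun h hc => ⟨_, h hc⟩
  constructor
  · rintro ⟨⟨a, b⟩, hab, rfl⟩ hc
    exact (hwin b).1 hc hab
  · intro hc
    obtain ⟨d, hd⟩ := (hwin 0).2 hc
    exact ⟨(a, d), hd, rfl⟩

theorem not_winII_guessingGame (hC : ¬ MeasurableSet (Prod.fst '' C)) :
    ¬ borelModel.WinII (guessingGame C) := by
  rintro ⟨P, hPm, hP⟩
  have hreply : Measurable fun a : Baire => strategy P [a] :=
    (measurable_strategy_ofFn hPm 1).comp (measurable_pi_lambda (fun a _ => a) fun _ =>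
      measurable_id)
  have hX : Prod.fst '' C = {a | strategy P [a] 0 ≠ 0} :=
    ext (mem_fst_image_iff_of_playerII_wins hP)
  refine hC ?_
  rw [hX]
  exact ((measurable_pi_apply 0).comp hreply) (MeasurableSet.of_discrete (s := {0}ᶜ))

end GuessingGame

end HigherRM


theorem mainTheorem5 :
    -- the model of Borel functionals satisfies comparability of well-orderings of sets of reals,
    borelModel.CWO ∧
    -- indeed all its well-orderings of sets of reals are countable;
    (∀ W ∈ borelModel.functionals, IsWellOrdering W → (dom W).Countable) ∧
    -- it does not satisfy clopen determinacy for reals,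
    ¬ borelModel.ClopenDet ∧
    -- as witnessed by the guessing game of a non-Borel analytic set.
    (∃ X : Set Baire, MeasureTheory.AnalyticSet X ∧ ¬ MeasurableSet X ∧
      ∃ C : Set (Baire × Baire), IsClosed C ∧ Prod.fst '' C = X ∧
        charFun (guessingGame C) ∈ borelModel.functionals ∧
        strings (charFun (guessingGame C)) = guessingGame C ∧
        IsTree (guessingGame C) ∧ IsWellFounded (guessingGame C) ∧
        ¬ borelModel.WinI (guessingGame C) ∧ ¬ borelModel.WinII (guessingGame C)) := by
  obtain ⟨C, hC, hX⟩ := exists_isClosed_not_measurableSet_fst_image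
  have hm := measurable_charFun_guessingGame hC.measurableSet
  have hT := isTree_guessingGame C
  have hwf := isWellFounded_guessingGame C
  have hI := not_winI_guessingGame C
  have hII := not_winII_guessingGame hX
  have hdet : ¬ borelModel.ClopenDet :=
    OmegaModel.not_clopenDet_of_not_winI_of_not_winII hm hT hwf hI hII
  have hanalytic := hC.analyticSet.image_of_continuous continuous_fst
  exact ⟨borelModel_cwo, fun W hW h => h.countable_dom hW, hdet, _, hanalytic, hX, C, hC, rfl,
    hm, strings_charFun _, hT, hwf, hI, hII⟩
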